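/- A weak composition is a sequence $\gamma=(\gamma_1,\gamma_2,\dots)$ of nonnegative integers with finitely many nonzero terms (trailing zeros are disregarded), and $|\gamma|=\sum_i\gamma_i$. A partition is a weakly decreasing weak composition, and $\lambda(\gamma)$ denotes the partition with the same nonzero parts as $\gamma$, counted with multiplicity. The diagram of $\gamma$ has boxes $(i,j)$ with $1\le j\le\gamma_i$ (row $i$, column $j$). A set-valued filling $F$ assigns to each box a non-empty finite set $F(i,j)$ of positive integers; its content is the weak composition $\delta$ in which $\delta_e$ is the number of boxes containing $e$, $x^F=\prod_e x_e^{\delta_e}$ and $|F|=|\delta|$. The anchor entry of a box is its maximum; all other entries are free. For non-empty sets, $A\ge B$ means $\min A\ge\max B$, and $A>B$ means $\min A>\max B$. Add the basement column $F(i,0)=\{i\}$ for every $i\geq 1$ (it is not counted in $x^F$ or $|F|$). Call $F$ a semistandard set-valued skyline filling of shape $\gamma$ with basement $b_i=i$ if: (S1) no entry occurs in two boxes of the same column; (S2) every row, including its basement box, is weakly decreasing from left to right; (S3) every triple of anchor entries $a,b,c$ of one of the following two types (the boxes may lie in the basement) is an inversion triple, i.e. $b>c\ge a$ or $c\ge a>b$.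 Type A: $i<i'$ and $\gamma_i\ge\gamma_{i'}\geq j\geq 1$, with $c,a,b$ the anchor entries of $(i,j-1)$, $(i,j)$, $(i',j)$ respectively. Type B: $i<i'$, $\gamma_i<\gamma_{i'}$ and $1\le j\le\gamma_i+1$, with $b,c,a$ the anchor entries of $(i,j-1)$, $(i',j-1)$, $(i',j)$ respectively; (S4) every free entry is in the highest possible row: if $e$ is a free entry of the box $(i,j)$, then there is no $i'<i$ such that $(i',j)$ is a box of the diagram with anchor entry greater than $e$ and row $i'$ still satisfies (S2) after $e$ is added to the box $(i',j)$. Let $\mathsf{SetSkyFill}(\gamma)$ be the set of these fillings (it is finite). The combinatorial Lascoux atom is the polynomial $$\mathcal L_\gamma=\sum_{F\in\mathsf{SetSkyFill}(\gamma)}\beta^{|F|-|\gamma|}x^F\in\mathbb Z[\beta][x_1,x_2,\dots].$$ For a partition $\lambda$, let $\mathsf{SetRT}(\lambda)$ be the set of set-valued reverse tableaux of shape $\lambda$, i.e. set-valued fillings $T$ of the diagram of $\lambda$ such that $T(i,j)\ge T(i,j+1)$ and $T(i,j)>T(i+1,j)$ whenever both boxes exist. The symmetric Grothendieck function is the formal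 power series $$G_\lambda=\sum_{T\in\mathsf{SetRT}(\lambda)}\beta^{|T|-|\lambda|}x^T\in\mathbb Z[\beta][[x_1,x_2,\dots]].$$ **Theorem.** For every partition $\lambda$, $$G_\lambda=\sum_{\lambda(\gamma)=\lambda}\mathcal L_\gamma,$$ where the sum is over all weak compositions $\gamma$ with $\lambda(\gamma)=\lambda$, as an identity of formal power series: each monomial in the $x_e$ has a nonzero coefficient in only finitely many of the $\mathcal L_\gamma$, and these coefficients add up to its coefficient in $G_\lambda$. -/

import Mathlib

open Polynomial

noncomputable section

namespace SkylineFilling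

/-! Weak compositions are finitely supported sequences `γ : ℕ+ →₀ ℕ` of nonnegative integers, so
that two weak compositions differing only by trailing zero parts are identified.  Coefficients are
taken in `ℤ[X]`, the variable `X` being the deformation parameter `β`. -/

/-- The boxes of the left-justified diagram of `γ`: row `i` has the boxes in columns
`1, …, γ i`. -/
def boxes (γ : ℕ+ →₀ ℕ) : Finset (ℕ+ × ℕ) :=
  γ.support.biUnion fun i => (Finset.Icc 1 (γ i)).image fun j => (i, j)

/-- `F` assigns a non-empty finite set of positive integers to each box of the diagram of `γ`
(and, by convention, the empty set to every position outside the diagram). -/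
def IsFilling (γ : ℕ+ →₀ ℕ) (F : ℕ+ → ℕ → Finset ℕ+) : Prop :=
  ∀ i j, (F i j).Nonempty ↔ (i, j) ∈ boxes γ

/-- The content of a filling: its value at `e` is the number of boxes containing `e`. -/
def content (γ : ℕ+ →₀ ℕ) (F : ℕ+ → ℕ → Finset ℕ+) : ℕ+ →₀ ℕ :=
  ∑ c ∈ boxes γ, ∑ e ∈ F c.1 c.2, Finsupp.single e 1

/-- The size `|γ|` of a weak composition (the sum of its parts).  The size of a filling is the size
of its content. -/
def size (γ : ℕ+ →₀ ℕ) : ℕ := γ.sum fun _ m => m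

/-- The filling `F` extended by the basement, a column 0 with the value `i` in row `i`. -/
def withBasement (F : ℕ+ → ℕ → Finset ℕ+) (i : ℕ+) (j : ℕ) : Finset ℕ+ :=
  if j = 0 then {i} else F i j

/-- The anchor entry (largest entry) of a box. It is `⊥` only for the empty set. -/
def anchor (A : Finset ℕ+) : WithBot ℕ+ := A.max

/-- `A ≥ B` for sets of entries: every entry of `A` is at least every entry of `B`,
i.e. `min A ≥ max B` when both are non-empty. -/
def SetGE (A B : Finset ℕ+) : Prop := ∀ x ∈ A, ∀ y ∈ B, y ≤ x

/-- `A > B` for sets of entries, i.e. `min A > max B` when both are non-empty. -/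
def SetGT (A B : Finset ℕ+) : Prop := ∀ x ∈ A, ∀ y ∈ B, y < x

/-- A row is weakly decreasing from left to right. (Empty positions lie only to the right of all the
boxes of a row, or in column 0 of a row without basement, and impose nothing.) -/
def RowDecreasing (r : ℕ → Finset ℕ+) : Prop := ∀ j, SetGE (r j) (r (j + 1))

/-- Inversion triples: `b > c ≥ a` or `c ≥ a > b`. -/
def IsInversion (a b c : WithBot ℕ+) : Prop := (c < b ∧ a ≤ c) ∨ (a ≤ c ∧ b < a)

/-- Semistandard set-valued skyline fillings of shape `γ` with basement `b_i = i`. -/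
structure IsSetSkyFill (γ : ℕ+ →₀ ℕ) (F : ℕ+ → ℕ → Finset ℕ+) : Prop where
  filling : IsFilling γ F
  /-- Entries do not repeat in a column. -/
  column : ∀ i i' j, i ≠ i' → Disjoint (F i j) (F i' j)
  /-- Rows, including the basement, are weakly decreasing. -/
  row : ∀ i, RowDecreasing (withBasement F i)
  /-- Triples of type A: `c, a` in columns `j, j + 1` of the upper row `i`, and `b` in column `j + 1`
  of the lower row `i'`, where the upper row is weakly longer. -/
  tripleA : ∀ i i' j, i < i' → γ i' ≤ γ i → j + 1 ≤ γ i' →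
    IsInversion (anchor (F i (j + 1))) (anchor (F i' (j + 1))) (anchor (withBasement F i j))
  /-- Triples of type B: `b` in column `j` of the upper row `i`, and `c, a` in columns `j, j + 1` of
  the lower row `i'`, where the lower row is strictly longer. -/
  tripleB : ∀ i i' j, i < i' → γ i < γ i' → j ≤ γ i →
    IsInversion (anchor (F i' (j + 1))) (anchor (withBasement F i j)) (anchor (withBasement F i' j))
  /-- Every free (that is, non-anchor) entry `e` is as high as possible: it cannot be put, as a free
  entry, in a box of the same column in a higher row while keeping that row weakly decreasing. -/
  free : ∀ i j, ∀ e ∈ F i j, (e : WithBot ℕ+) ≠ anchor (F i j) →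
    ∀ i' < i, (i', j) ∈ boxes γ → (e : WithBot ℕ+) < anchor (F i' j) →
      ¬ RowDecreasing (Function.update (withBasement F i') j (insert e (F i' j)))

/-- Set-valued reverse tableaux of shape `lam`: rows weakly decrease and columns strictly
decrease. -/
structure IsSetRT (lam : ℕ+ →₀ ℕ) (T : ℕ+ → ℕ → Finset ℕ+) : Prop where
  filling : IsFilling lam T
  row : ∀ i, RowDecreasing (T i)
  column : ∀ i j, SetGT (T i j) (T (i + 1) j)

theorem mem_boxes {γ : ℕ+ →₀ ℕ} {i : ℕ+} {j : ℕ} : (i, j) ∈ boxes γ ↔ 1 ≤ j ∧ j ≤ γ i := by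
  simp only [boxes, Finset.mem_biUnion, Finsupp.mem_support_iff, Finset.mem_image, Finset.mem_Icc,
    Prod.mk.injEq]
  constructor
  · rintro ⟨a, _, b, hb, rfl, rfl⟩
    exact hb
  · intro h
    exact ⟨i, by omega, j, h, rfl, rfl⟩

theorem finite_fillings (γ : ℕ+ →₀ ℕ) (E : Finset ℕ+) :
    {F | IsFilling γ F ∧ ∀ i j, F i j ⊆ E}.Finite := by
  apply Set.Finite.of_finite_image (f := fun F (c : boxes γ) => F c.1.1 c.1.2)
  · refine (Set.Finite.pi (t := fun _ : boxes γ => (E.powerset : Set (Finset ℕ+)))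
      fun _ => Finset.finite_toSet _).subset ?_
    rintro _ ⟨F, hF, rfl⟩ c _
    simpa using hF.2 c.1.1 c.1.2
  · intro F hF G hG h
    funext i j
    by_cases hc : (i, j) ∈ boxes γ
    · exact congrFun h ⟨(i, j), hc⟩
    · have h1 := mt (hF.1 i j).1 hc
      have h2 := mt (hG.1 i j).1 hc
      rw [Finset.not_nonempty_iff_eq_empty] at h1 h2
      rw [h1, h2]

theorem IsSetSkyFill.le_row {γ : ℕ+ →₀ ℕ} {F : ℕ+ → ℕ → Finset ℕ+} (hF : IsSetSkyFill γ F)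
    (i : ℕ+) (j : ℕ) : ∀ e ∈ F i (j + 1), e ≤ i := by
  induction j with
  | zero =>
    intro e he
    exact hF.row i 0 i (by simp [withBasement]) e (by simpa [withBasement] using he)
  | succ j ih =>
    intro e he
    have h1 := mem_boxes.1 ((hF.filling i (j + 1 + 1)).1 ⟨e, he⟩)
    obtain ⟨x, hx⟩ := (hF.filling i (j + 1)).2 (mem_boxes.2 (by omega))
    exact (hF.row i (j + 1) x (by simpa [withBasement] using hx) e
      (by simpa [withBasement] using he)).trans (ih x hx)

theorem finite_setSkyFill (γ : ℕ+ →₀ ℕ) : {F | IsSetSkyFill γ F}.Finite := by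
  refine (finite_fillings γ (γ.support.biUnion fun i => Finset.Icc 1 i)).subset ?_
  intro F hF
  refine ⟨hF.filling, fun i j e he => ?_⟩
  have h1 := mem_boxes.1 ((hF.filling i j).1 ⟨e, he⟩)
  obtain ⟨j, rfl⟩ : ∃ k, j = k + 1 := ⟨j - 1, by omega⟩
  have h2 := hF.le_row i j e he
  simp only [Finset.mem_biUnion, Finsupp.mem_support_iff, Finset.mem_Icc]
  exact ⟨i, by omega, one_le, h2⟩

theorem finite_setRT (lam d : ℕ+ →₀ ℕ) : {T | IsSetRT lam T ∧ content lam T = d}.Finite := by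
  refine (finite_fillings lam d.support).subset ?_
  rintro T ⟨hT, rfl⟩
  refine ⟨hT.filling, fun i j e he => ?_⟩
  have h1 := (hT.filling i j).1 ⟨e, he⟩
  rw [Finsupp.mem_support_iff, content, Finsupp.finsetSum_apply]
  intro h
  have h2 := Finset.sum_eq_zero_iff.1 h (i, j) h1
  rw [Finsupp.finsetSum_apply] at h2
  have h3 := Finset.sum_eq_zero_iff.1 h2 e he
  simp at h3

/-- The combinatorial Lascoux atom `∑ β ^ (|F| - |γ|) x ^ F`, over the semistandard set-valued
skyline fillings `F` of shape `γ` with basement `b_i = i` (the subtraction never truncates, boxes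
being non-empty). -/
def lascouxAtom (γ : ℕ+ →₀ ℕ) : MvPolynomial ℕ+ ℤ[X] :=
  ∑ F ∈ (finite_setSkyFill γ).toFinset,
    MvPolynomial.monomial (content γ F) (X ^ (size (content γ F) - size γ))

/-- The symmetric Grothendieck function `∑ β ^ (|T| - |lam|) x ^ T`, over the set-valued reverse
tableaux `T` of shape `lam`, as a formal power series: its coefficient at `x ^ d` is the sum of
`β ^ (|T| - |lam|)` over the finitely many `T` of content `d`. -/
def grothendieck (lam : ℕ+ →₀ ℕ) : MvPowerSeries ℕ+ ℤ[X] := fun d =>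
  ∑ T ∈ (finite_setRT lam d).toFinset, X ^ (size (content lam T) - size lam)

/-- `γ` and `lam` have the same multiset of nonzero parts. For `lam` a partition (that is, weakly
decreasing) this says that `lam` is the partition `λ(γ)` obtained by sorting the parts of `γ`. -/
def SameParts (γ lam : ℕ+ →₀ ℕ) : Prop :=
  γ.support.val.map γ = lam.support.val.map lam

/-- `g` is the (possibly infinite) formal sum of the power series `f k`: each monomial has a nonzero
coefficient in only finitely many `f k`, and these coefficients add up to that of `g`. -/
def IsFormalSum {ι σ R : Type*} [CommRing R] (f : ι → MvPowerSeries σ R)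
    (g : MvPowerSeries σ R) : Prop :=
  ∀ d : σ →₀ ℕ, {k | MvPowerSeries.coeff d (f k) ≠ 0}.Finite ∧
    MvPowerSeries.coeff d g = ∑ᶠ k, MvPowerSeries.coeff d (f k)

end SkylineFilling

end

namespace SkylineFilling

/-! A filling of either kind is recovered from two pieces of data per column: the set of its anchors
and the set of all its entries. Neither the order of the rows nor the shape has to be recorded, so
matching fillings with equal data gives a content-preserving bijection.

The common description is `GreedyFill`. In each column the anchors are placed in decreasing order,
each in the highest vacant row where it is allowed, which means that the previous anchor of that row
is at least as large. Each free entry then goes to an extremal row among those that can hold it.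
Skyline fillings arise from the basement rule `e ≤ i` and the highest such row: the triple
conditions amount to greediness. Reverse tableaux arise when every row is allowed in the first
column and free entries go as low as possible.

Uniqueness is `IsGreedyColumn.eq_of_entries` together with `GreedyFill.eq_of_entries_eq`. Existence
is `GreedyFill.exists_rearrangement`: the counting conditions that let the placement go through
depend only on the column sets, so they pass from one basement and placement rule to another. Column
heights are preserved, hence so is the multiset of parts. -/

/-! ### Greedy columns -/

/-- The entries occurring in a column of (at most one) entries. -/
def entries (q : ℕ+ → WithBot ℕ+) : Set ℕ+ := {e | ∃ i, q i = e}

/-- A column is greedy relative to a relation `P i e` ("`e` is allowed in row `i`") if every entry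
is allowed in its row, no entry occurs twice, and every higher row in which an entry would be
allowed holds a larger entry. -/
structure IsGreedyColumn (P : ℕ+ → ℕ+ → Prop) (q : ℕ+ → WithBot ℕ+) : Prop where
  allowed : ∀ i (e : ℕ+), q i = e → P i e
  inj : ∀ i r (e : ℕ+), q i = e → q r = e → i = r
  greedy : ∀ i r (e : ℕ+), i < r → q r = e → P i e → (e : WithBot ℕ+) < q i

/-- Consider the largest entry `e` placed differently in the two columns. In the column where `e`
sits lower, greediness puts a larger entry in the higher of its two rows; larger entries agree, but
the other column has `e` there. -/
theorem IsGreedyColumn.eq_of_entries {P : ℕ+ → ℕ+ → Prop} {q q' : ℕ+ → WithBot ℕ+}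
    (h : IsGreedyColumn P q) (h' : IsGreedyColumn P q') (he : entries q = entries q')
    (hfin : (entries q).Finite) : q = q' := by
  have key : ∀ e : ℕ+, ∀ i, q i = e ↔ q' i = e := by
    by_contra hcon
    set B : Set ℕ+ := {e | ∃ i, ¬ (q i = e ↔ q' i = e)} with hB
    have hBsub : B ⊆ entries q := by
      rintro e ⟨i, hi⟩
      by_cases h1 : q i = e
      · exact ⟨i, h1⟩
      · have h2 : q' i = e := by tauto
        rw [he]
        exact ⟨i, h2⟩
    have hne : B.Nonempty := by
      push Not at hcon
      obtain ⟨e, i, hi⟩ := hcon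
      exact ⟨e, i, by tauto⟩
    obtain ⟨e, heB, hmax⟩ := Set.exists_max_image B id (hfin.subset hBsub) hne
    have hbig : ∀ f : ℕ+, e < f → ∀ i, q i = f ↔ q' i = f := by
      intro f hf i
      by_contra hc
      exact absurd (hmax f ⟨i, hc⟩) (not_le.2 hf)
    obtain ⟨r, hr⟩ := hBsub heB
    obtain ⟨r', hr'⟩ := he ▸ hBsub heB
    rcases lt_trichotomy r r' with hlt | rfl | hlt
    · have h1 := h'.greedy r r' e hlt hr' (h.allowed r e hr)
      obtain ⟨f, hf⟩ := WithBot.ne_bot_iff_exists.1 h1.ne_bot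
      rw [← hf, WithBot.coe_lt_coe] at h1
      have h2 := (hbig f h1 r).2 hf.symm
      rw [hr, WithBot.coe_inj] at h2
      exact h1.ne h2
    · obtain ⟨i, hi⟩ := heB
      refine hi ⟨fun h1 => ?_, fun h1 => ?_⟩
      · rw [h.inj i r e h1 hr, hr']
      · rw [h'.inj i r e h1 hr', hr]
    · have h1 := h.greedy r' r e hlt hr (h'.allowed r' e hr')
      obtain ⟨f, hf⟩ := WithBot.ne_bot_iff_exists.1 h1.ne_bot
      rw [← hf, WithBot.coe_lt_coe] at h1
      have h2 := (hbig f h1 r').1 hf.symm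
      rw [hr', WithBot.coe_inj] at h2
      exact h1.ne h2
  funext i
  cases hq : q i with
  | bot =>
    cases hq' : q' i with
    | bot => rfl
    | coe e => rw [(key e i).2 hq'] at hq; exact absurd hq WithBot.coe_ne_bot
  | coe e => exact ((key e i).1 hq).symm

/-- This turns counts of rows into counts of entries, which no longer depend on how the column is
arranged. -/
theorem IsGreedyColumn.encard_rows {P : ℕ+ → ℕ+ → Prop} {q : ℕ+ → WithBot ℕ+}
    (h : IsGreedyColumn P q) (S : ℕ+ → Prop) :
    {i | ∃ e : ℕ+, q i = e ∧ S e}.encard = {e ∈ entries q | S e}.encard := by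
  have h1 : ((↑) : ℕ+ → WithBot ℕ+) '' {e ∈ entries q | S e} =
      q '' {i | ∃ e : ℕ+, q i = e ∧ S e} := by
    ext x
    constructor
    · rintro ⟨e, ⟨⟨i, hi⟩, hS⟩, rfl⟩
      exact ⟨i, ⟨e, hi, hS⟩, hi⟩
    · rintro ⟨i, ⟨e, hi, hS⟩, rfl⟩
      exact ⟨e, ⟨⟨i, hi⟩, hS⟩, hi.symm⟩
  have h2 : Set.InjOn q {i | ∃ e : ℕ+, q i = e ∧ S e} := by
    rintro i ⟨e, hi, -⟩ r - hir
    exact h.inj i r e hi (hir ▸ hi)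
  rw [← h2.encard_image, ← h1, WithBot.coe_injective.encard_image]

/-- A Hall-type condition suffices: insert the entries in decreasing order, each in the topmost
vacant allowed row. Later, smaller entries only fill vacant rows, so greediness persists. -/
theorem exists_greedyColumn (P : ℕ+ → ℕ+ → Prop) (A : Finset ℕ+)
    (hA : ∀ x ∈ A, {a ∈ (A : Set ℕ+) | x ≤ a}.encard ≤ {i | P i x}.encard) :
    ∃ q, IsGreedyColumn P q ∧ entries q = A := by
  induction A using Finset.induction_on_min with
  | empty =>
    refine ⟨fun _ => ⊥, ⟨?_, ?_, ?_⟩, ?_⟩ <;> simp [entries]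
  | insert e A hlt ih =>
    have heA : e ∉ A := fun h => lt_irrefl _ (hlt e h)
    obtain ⟨q, hq, hent⟩ := ih fun x hx => by
      refine le_trans (Set.encard_le_encard ?_) (hA x (Finset.mem_insert_of_mem hx))
      rintro a ⟨ha, hxa⟩
      exact ⟨by simpa using Or.inr ha, hxa⟩
    have hqA : ∀ i (f : ℕ+), q i = f → e < f := fun i f hf =>
      hlt f (Finset.mem_coe.1 (hent ▸ ⟨i, hf⟩))
    -- Were all rows allowed for `e` occupied, the hypothesis at `e` would bound the size of `insert
    -- e A` by that of `A`.
    have hex : ∃ i, P i e ∧ q i = ⊥ := by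
      by_contra hcon
      push Not at hcon
      have h1 : {i | P i e} ⊆ {i | ∃ e : ℕ+, q i = e ∧ True} := by
        intro i hi
        obtain ⟨f, hf⟩ := WithBot.ne_bot_iff_exists.1 (hcon i hi)
        exact ⟨f, hf.symm, trivial⟩
      have h2 := (hA e (Finset.mem_insert_self _ _)).trans (Set.encard_le_encard h1)
      rw [hq.encard_rows] at h2
      have h3 : {a ∈ ((insert e A : Finset ℕ+) : Set ℕ+) | e ≤ a} = (insert e A : Finset ℕ+) := by
        ext a
        simp only [Set.mem_ofPred_eq, Finset.mem_coe, and_iff_left_iff_imp, Finset.mem_insert]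
        rintro (rfl | ha)
        · exact le_rfl
        · exact (hlt a ha).le
      have h4 : {a ∈ entries q | True} = (A : Set ℕ+) := by simp [hent]
      rw [h3, h4, Set.encard_coe_eq_coe_finsetCard, Set.encard_coe_eq_coe_finsetCard,
        Finset.card_insert_of_notMem heA] at h2
      norm_cast at h2
      omega
    classical
    let r := WellFounded.min (wellFounded_lt (α := ℕ+)) {i | P i e ∧ q i = ⊥} hex
    have hr : P r e ∧ q r = ⊥ := WellFounded.min_mem _ _ hex
    have hmin : ∀ i < r, P i e → q i ≠ ⊥ := fun i hi hP hb =>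
      WellFounded.not_lt_min _ {i | P i e ∧ q i = ⊥} (x := i) ⟨hP, hb⟩ hi
    refine ⟨Function.update q r e, ⟨?_, ?_, ?_⟩, ?_⟩
    · intro i f hf
      by_cases hi : i = r
      · subst hi
        rw [Function.update_self, WithBot.coe_inj] at hf
        exact hf ▸ hr.1
      · rw [Function.update_of_ne hi] at hf
        exact hq.allowed i f hf
    · intro i k f hi hk
      by_cases h1 : i = r <;> by_cases h2 : k = r
      · rw [h1, h2]
      · subst h1
        rw [Function.update_self, WithBot.coe_inj] at hi
        rw [Function.update_of_ne h2] at hk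
        exact absurd hi (hqA k f hk).ne
      · subst h2
        rw [Function.update_self, WithBot.coe_inj] at hk
        rw [Function.update_of_ne h1] at hi
        exact absurd hk (hqA i f hi).ne
      · rw [Function.update_of_ne h1] at hi
        rw [Function.update_of_ne h2] at hk
        exact hq.inj i k f hi hk
    · intro i k f hik hk hP
      by_cases h2 : k = r
      · subst h2
        rw [Function.update_self, WithBot.coe_inj] at hk
        subst hk
        rw [Function.update_of_ne hik.ne]
        obtain ⟨g, hg⟩ := WithBot.ne_bot_iff_exists.1 (hmin i hik hP)
        rw [← hg, WithBot.coe_lt_coe]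
        exact hqA i g hg.symm
      · rw [Function.update_of_ne h2] at hk
        have h3 := hq.greedy i k f hik hk hP
        rw [Function.update_of_ne]
        · exact h3
        · rintro rfl
          rw [hr.2] at h3
          exact not_lt_bot h3
    · ext f
      simp only [entries, Set.mem_ofPred_eq, Finset.mem_coe, Finset.mem_insert]
      constructor
      · rintro ⟨i, hi⟩
        by_cases h1 : i = r
        · subst h1
          rw [Function.update_self, WithBot.coe_inj] at hi
          exact Or.inl hi.symm
        · rw [Function.update_of_ne h1] at hi
          exact Or.inr (Finset.mem_coe.1 (hent ▸ ⟨i, hi⟩))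
      · rintro (rfl | hf)
        · exact ⟨r, Function.update_self ..⟩
        · obtain ⟨i, hi⟩ : f ∈ entries q := by rw [hent]; exact hf
          refine ⟨i, ?_⟩
          rw [Function.update_of_ne]
          · exact hi
          · rintro rfl
            rw [hr.2] at hi
            exact WithBot.coe_ne_bot hi.symm

/-! ### Greedy set-valued fillings: uniqueness and rearrangement -/

/-- Column `j` of anchor entries. -/
def anchors (F : ℕ+ → ℕ → Finset ℕ+) (j : ℕ) (i : ℕ+) : WithBot ℕ+ := anchor (F i j)

/-- The entries occurring in column `j`. -/
def columnSet (F : ℕ+ → ℕ → Finset ℕ+) (j : ℕ) : Set ℕ+ := {e | ∃ i, e ∈ F i j}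

/-- The rows allowed for an entry in column `j + 1`, when column `j` is `p`; the first column is
governed by the basement relation `Q`. -/
def allowedAfter (Q : ℕ+ → ℕ+ → Prop) (j : ℕ) (p : ℕ+ → WithBot ℕ+) (i e : ℕ+) : Prop :=
  if j = 0 then Q i e else (e : WithBot ℕ+) ≤ p i

/-- Given two consecutive columns `p`, `p'` of anchors, row `i` can hold `e` as a free entry. -/
def Eligible (p p' : ℕ+ → WithBot ℕ+) (e i : ℕ+) : Prop := p' i ≤ e ∧ (e : WithBot ℕ+) < p i

/-- Set-valued fillings with greedy columns of anchors, in which each free entry occupies an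
`R`-minimal eligible row. -/
structure GreedyFill (Q R : ℕ+ → ℕ+ → Prop) (F : ℕ+ → ℕ → Finset ℕ+) : Prop where
  bounded : ∃ N, ∀ j, N ≤ j → ∀ i, F i j = ∅
  finite : ∀ j, (columnSet F j).Finite
  zero : ∀ i, F i 0 = ∅
  disjoint : ∀ i i' j e, e ∈ F i j → e ∈ F i' j → i = i'
  greedy : ∀ j, IsGreedyColumn (allowedAfter Q j (anchors F j)) (anchors F (j + 1))
  row : ∀ i j, ∀ e ∈ F i j, anchors F (j + 1) i ≤ e
  free : ∀ i j, ∀ e ∈ F i j, (e : WithBot ℕ+) ≠ anchors F j i →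
    ∀ i', R i' i → ¬ Eligible (anchors F j) (anchors F (j + 1)) e i'

theorem mem_of_anchors {F : ℕ+ → ℕ → Finset ℕ+} {i e : ℕ+} {j : ℕ} (h : anchors F j i = e) :
    e ∈ F i j := Finset.mem_of_max h

theorem le_anchors {F : ℕ+ → ℕ → Finset ℕ+} {i e : ℕ+} {j : ℕ} (h : e ∈ F i j) :
    (e : WithBot ℕ+) ≤ anchors F j i := Finset.le_max h

theorem anchors_eq_bot {F : ℕ+ → ℕ → Finset ℕ+} {i : ℕ+} {j : ℕ} :
    anchors F j i = ⊥ ↔ F i j = ∅ := Finset.max_eq_bot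

theorem entries_anchors_subset (F : ℕ+ → ℕ → Finset ℕ+) (j : ℕ) :
    entries (anchors F j) ⊆ columnSet F j := fun _ ⟨i, hi⟩ => ⟨i, mem_of_anchors hi⟩

theorem entries_bot : entries ⊥ = ∅ := by
  ext e
  simp [entries]

theorem eq_bot_of_entries {q : ℕ+ → WithBot ℕ+} (h : entries q = ∅) : q = ⊥ := by
  funext i
  cases hq : q i with
  | bot => rfl
  | coe e => exact (Set.eq_empty_iff_forall_notMem.1 h e ⟨i, hq⟩).elim

theorem setOf_coe_le (q : ℕ+ → WithBot ℕ+) (x : ℕ+) :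
    {i | (x : WithBot ℕ+) ≤ q i} = {i | ∃ e : ℕ+, q i = e ∧ x ≤ e} := by
  ext i
  cases h : q i <;> simp [h]

theorem setOf_coe_lt (q : ℕ+ → WithBot ℕ+) (x : ℕ+) :
    {i | (x : WithBot ℕ+) < q i} = {i | ∃ e : ℕ+, q i = e ∧ x < e} := by
  ext i
  cases h : q i <;> simp [h]

theorem setOf_ne_bot (q : ℕ+ → WithBot ℕ+) :
    {i | q i ≠ ⊥} = {i | ∃ e : ℕ+, q i = e ∧ True} := by
  ext i
  cases h : q i <;> simp [h]

namespace GreedyFill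

variable {Q R : ℕ+ → ℕ+ → Prop} {F : ℕ+ → ℕ → Finset ℕ+}

theorem anchors_zero (hF : GreedyFill Q R F) : anchors F 0 = ⊥ := by
  funext i
  exact anchors_eq_bot.2 (hF.zero i)

theorem finite_entries (hF : GreedyFill Q R F) (j : ℕ) : (entries (anchors F j)).Finite :=
  (hF.finite j).subset (entries_anchors_subset F j)

theorem exists_isGreedyColumn (hF : GreedyFill Q R F) (j : ℕ) :
    ∃ P, IsGreedyColumn P (anchors F j) := by
  cases j with
  | zero =>
    rw [hF.anchors_zero]
    refine ⟨fun _ _ => True, ?_, ?_, ?_⟩ <;> simp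
  | succ j => exact ⟨_, hF.greedy j⟩

theorem anchors_succ_le (hF : GreedyFill Q R F) (i : ℕ+) (j : ℕ) :
    anchors F (j + 2) i ≤ anchors F (j + 1) i := by
  cases h : anchors F (j + 2) i with
  | bot => exact bot_le
  | coe e => simpa [allowedAfter] using (hF.greedy (j + 1)).allowed i e h

theorem anchors_eq (hF : GreedyFill Q R F) {R' : ℕ+ → ℕ+ → Prop} {F' : ℕ+ → ℕ → Finset ℕ+}
    (hF' : GreedyFill Q R' F') (h : ∀ j, entries (anchors F j) = entries (anchors F' j)) (j : ℕ) :
    anchors F j = anchors F' j := by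
  induction j with
  | zero => rw [hF.anchors_zero, hF'.anchors_zero]
  | succ j ih =>
    have h1 := hF.greedy j
    rw [ih] at h1
    exact h1.eq_of_entries (hF'.greedy j) (h _) (hF.finite_entries _)

/-- The anchors agree column by column, so both fillings have the same eligible rows for a free
entry, and trichotomy of `R` leaves only one `R`-minimal row among them. -/
theorem subset_of_entries_eq [Std.Trichotomous R] (hF : GreedyFill Q R F)
    {F' : ℕ+ → ℕ → Finset ℕ+} (hF' : GreedyFill Q R F')
    (h : ∀ j, entries (anchors F j) = entries (anchors F' j))
    (hc : ∀ j, columnSet F j = columnSet F' j) (i : ℕ+) (j : ℕ) : F i j ⊆ F' i j := by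
  have ha := hF.anchors_eq hF' h
  intro e he
  by_cases h1 : (e : WithBot ℕ+) = anchors F j i
  · rw [ha] at h1
    exact mem_of_anchors h1.symm
  · obtain ⟨r, hr⟩ : e ∈ columnSet F' j := hc j ▸ ⟨i, he⟩
    have h2 : (e : WithBot ℕ+) ≠ anchors F' j r := by
      intro h2
      rw [← ha] at h2
      rw [hF.disjoint i r j e he (mem_of_anchors h2.symm)] at h1
      exact h1 h2
    have h3 : Eligible (anchors F j) (anchors F (j + 1)) e i :=
      ⟨hF.row i j e he, lt_of_le_of_ne (le_anchors he) h1⟩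
    have h4 : Eligible (anchors F' j) (anchors F' (j + 1)) e r :=
      ⟨hF'.row r j e hr, lt_of_le_of_ne (le_anchors hr) h2⟩
    rw [← ha, ← ha] at h4
    have h5 : i = r := by
      refine Std.Trichotomous.trichotomous (r := R) i r (fun hlt => ?_) (fun hlt => ?_)
      · have := hF'.free r j e hr h2 i hlt
        rw [← ha, ← ha] at this
        exact this h3
      · exact hF.free i j e he h1 r hlt h4
    exact h5 ▸ hr

/-- A greedy filling is determined by the sets of anchors and of entries in its columns. -/
theorem eq_of_entries_eq [Std.Trichotomous R] (hF : GreedyFill Q R F)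
    {F' : ℕ+ → ℕ → Finset ℕ+} (hF' : GreedyFill Q R F')
    (h : ∀ j, entries (anchors F j) = entries (anchors F' j))
    (hc : ∀ j, columnSet F j = columnSet F' j) : F = F' := by
  funext i j
  exact (hF.subset_of_entries_eq hF' h hc i j).antisymm
    (hF'.subset_of_entries_eq hF (fun j => (h j).symm) (fun j => (hc j).symm) i j)

/-- Beyond the first column, the number of rows allowing `x` is the number of previous anchors `≥
x`, the same as in `F`, where rows decrease. In the first column, infinitely many rows are allowed.
-/
theorem exists_next_column (hF : GreedyFill Q R F) {Q' : ℕ+ → ℕ+ → Prop}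
    (hQ' : ∀ e, {i | Q' i e}.Infinite) (j : ℕ) {p : ℕ+ → WithBot ℕ+}
    (hp : ∃ P, IsGreedyColumn P p) (hpe : entries p = entries (anchors F j)) :
    ∃ q, IsGreedyColumn (allowedAfter Q' j p) q ∧ entries q = entries (anchors F (j + 1)) := by
  have h := exists_greedyColumn (allowedAfter Q' j p) (hF.finite_entries (j + 1)).toFinset
  rw [(hF.finite_entries (j + 1)).coe_toFinset] at h
  refine h fun x _ => ?_
  cases j with
  | zero => simp [allowedAfter, (hQ' x).encard_eq]
  | succ j =>
    obtain ⟨P, hP⟩ := hp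
    have h1 : {i | allowedAfter Q' (j + 1) p i x} = {i | (x : WithBot ℕ+) ≤ p i} := by
      simp [allowedAfter]
    rw [h1, setOf_coe_le, hP.encard_rows, hpe, ← (hF.greedy j).encard_rows,
      ← (hF.greedy (j + 1)).encard_rows, ← setOf_coe_le, ← setOf_coe_le]
    exact Set.encard_le_encard fun i hi => le_trans hi (hF.anchors_succ_le i j)

theorem exists_columns (hF : GreedyFill Q R F) {Q' : ℕ+ → ℕ+ → Prop}
    (hQ' : ∀ e, {i | Q' i e}.Infinite) :
    ∃ a : ℕ → ℕ+ → WithBot ℕ+, (∀ j, entries (a j) = entries (anchors F j)) ∧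
      (∀ j, IsGreedyColumn (allowedAfter Q' j (a j)) (a (j + 1))) := by
  -- The recursion must carry greediness and the entry set along, since the next column exists only
  -- because of both.
  let Good (j : ℕ) := {p : ℕ+ → WithBot ℕ+ //
    (∃ P, IsGreedyColumn P p) ∧ entries p = entries (anchors F j)}
  have hstep : ∀ (j : ℕ) (p : Good j), ∃ q : Good (j + 1),
      IsGreedyColumn (allowedAfter Q' j p.1) q.1 := fun j p => by
    obtain ⟨q, h1, h2⟩ := hF.exists_next_column hQ' j p.2.1 p.2.2
    exact ⟨⟨q, ⟨_, h1⟩, h2⟩, h1⟩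
  choose next hnext using hstep
  let a : ∀ j, Good j := fun j => Nat.rec ⟨_, hF.exists_isGreedyColumn 0, rfl⟩ next j
  exact ⟨fun j => (a j).1, fun j => (a j).2.2, fun j => hnext j (a j)⟩

/-- A row is eligible when its anchor exceeds `e` in `p` but not in `p'`. Strictly fewer rows exceed
`e` in `p'` than in `p`: the counts depend only on the entries, and in `F` the row holding the free
entry `e` makes the difference. -/
theorem exists_eligible (hF : GreedyFill Q R F) {p p' : ℕ+ → WithBot ℕ+} {j : ℕ}
    (hp : ∃ P, IsGreedyColumn P p) (hpe : entries p = entries (anchors F j))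
    (hp' : ∃ P, IsGreedyColumn P p') (hpe' : entries p' = entries (anchors F (j + 1))) {e : ℕ+}
    (he : e ∈ columnSet F j) (he' : e ∉ entries (anchors F j)) :
    {i | Eligible p p' e i}.Finite ∧ {i | Eligible p p' e i}.Nonempty := by
  obtain ⟨P, hP⟩ := hp
  obtain ⟨P', hP'⟩ := hp'
  obtain ⟨j, rfl⟩ : ∃ k, j = k + 1 := by
    cases j with
    | zero =>
      obtain ⟨i, hi⟩ := he
      simp [hF.zero i] at hi
    | succ k => exact ⟨k, rfl⟩
  have hfin : ∀ {q : ℕ+ → WithBot ℕ+} {P : ℕ+ → ℕ+ → Prop}, IsGreedyColumn P q →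
      entries q = entries (anchors F (j + 1)) → {i | (e : WithBot ℕ+) < q i}.Finite := by
    intro q P hq hqe
    rw [setOf_coe_lt, ← Set.encard_lt_top_iff, hq.encard_rows, Set.encard_lt_top_iff, hqe]
    exact (hF.finite_entries _).subset fun _ h => h.1
  refine ⟨(hfin hP hpe).subset fun i hi => hi.2, ?_⟩
  have hlt : {i | (e : WithBot ℕ+) < p' i}.encard < {i | (e : WithBot ℕ+) < p i}.encard := by
    rw [setOf_coe_lt, setOf_coe_lt, hP.encard_rows, hpe, hP'.encard_rows, hpe',
      ← (hF.greedy j).encard_rows, ← (hF.greedy (j + 1)).encard_rows, ← setOf_coe_lt,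
      ← setOf_coe_lt]
    have hsub : {i | (e : WithBot ℕ+) < anchors F (j + 1 + 1) i} ⊆
        {i | (e : WithBot ℕ+) < anchors F (j + 1) i} :=
      fun i hi => lt_of_lt_of_le hi (hF.anchors_succ_le i j)
    refine ((hfin (hF.greedy j) rfl).subset hsub).encard_lt_encard (hsub.ssubset_of_not_subset ?_)
    obtain ⟨i, hi⟩ := he
    intro hcon
    refine (hF.row i (j + 1) e hi).not_gt (hcon (lt_of_le_of_ne (le_anchors hi) fun h => ?_))
    exact he' ⟨i, h.symm⟩
  by_contra hcon
  refine hlt.not_ge (Set.encard_le_encard fun i hi => ?_)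
  by_contra hi'
  exact hcon ⟨i, not_lt.1 hi', hi⟩

/-- The columns of a greedy filling can be rearranged into a greedy filling for another basement
and another placement rule for free entries. -/
theorem exists_rearrangement (hF : GreedyFill Q R F) {Q' R' : ℕ+ → ℕ+ → Prop}
    (hQ' : ∀ e, {i | Q' i e}.Infinite)
    (hR' : ∀ s : Set ℕ+, s.Finite → s.Nonempty → ∃ m ∈ s, ∀ i ∈ s, ¬ R' i m) :
    ∃ F', GreedyFill Q' R' F' ∧ (∀ j, entries (anchors F j) = entries (anchors F' j)) ∧
      ∀ j, columnSet F j = columnSet F' j := by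
  classical
  obtain ⟨a, hae, hag⟩ := hF.exists_columns hQ'
  have hag' : ∀ j, ∃ P, IsGreedyColumn P (a j) := fun j => by
    cases j with
    | zero =>
      have : a 0 = anchors F 0 := by
        rw [hF.anchors_zero]
        exact eq_bot_of_entries (by rw [hae, hF.anchors_zero, entries_bot])
      rw [this]
      exact hF.exists_isGreedyColumn 0
    | succ j => exact ⟨_, hag j⟩
  have hsel : ∀ j e, ∃ r, e ∈ columnSet F j → e ∉ entries (anchors F j) →
      Eligible (a j) (a (j + 1)) e r ∧ ∀ i, Eligible (a j) (a (j + 1)) e i → ¬ R' i r := by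
    intro j e
    by_cases h : e ∈ columnSet F j ∧ e ∉ entries (anchors F j)
    · have h1 := hF.exists_eligible (hag' j) (hae j) (hag' (j + 1)) (hae (j + 1)) h.1 h.2
      obtain ⟨m, hm, hm'⟩ := hR' _ h1.1 h1.2
      exact ⟨m, fun _ _ => ⟨hm, hm'⟩⟩
    · exact ⟨1, fun h1 h2 => absurd ⟨h1, h2⟩ h⟩
  choose sel hsel using hsel
  let F' : ℕ+ → ℕ → Finset ℕ+ := fun i j => (hF.finite j).toFinset.filter fun e =>
    a j i = e ∨ (e ∉ entries (anchors F j) ∧ sel j e = i)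
  have hmem : ∀ i j e, e ∈ F' i j ↔ e ∈ columnSet F j ∧
      (a j i = e ∨ (e ∉ entries (anchors F j) ∧ sel j e = i)) := by
    intro i j e
    simp [F']
  -- Eligibility keeps free entries strictly below the prescribed anchors, so they do not alter the
  -- maxima.
  have hanc : anchors F' = a := by
    funext j i
    apply le_antisymm
    · refine Finset.max_le fun e he => ?_
      obtain ⟨h1, h2 | ⟨h2, rfl⟩⟩ := (hmem i j e).1 he
      · exact h2.ge
      · exact (hsel j e h1 h2).1.2.le
    · cases h : a j i with
      | bot => exact bot_le
      | coe e =>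
        refine le_anchors ((hmem i j e).2 ⟨entries_anchors_subset F j ?_, Or.inl h⟩)
        rw [← hae]
        exact ⟨i, h⟩
  have hcol : ∀ j, columnSet F j = columnSet F' j := by
    intro j
    ext e
    constructor
    · intro he
      by_cases h : e ∈ entries (anchors F j)
      · obtain ⟨i, hi⟩ : e ∈ entries (a j) := by rwa [hae]
        exact ⟨i, (hmem i j e).2 ⟨he, Or.inl hi⟩⟩
      · exact ⟨sel j e, (hmem _ j e).2 ⟨he, Or.inr ⟨h, rfl⟩⟩⟩
    · rintro ⟨i, hi⟩
      exact ((hmem i j e).1 hi).1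
  refine ⟨F', ⟨?_, ?_, ?_, ?_, ?_, ?_, ?_⟩, ?_, hcol⟩
  · obtain ⟨N, hN⟩ := hF.bounded
    refine ⟨N, fun j hj i => Finset.eq_empty_of_forall_notMem fun e he => ?_⟩
    obtain ⟨r, hr⟩ := ((hmem i j e).1 he).1
    simp [hN j hj r] at hr
  · intro j
    rw [← hcol]
    exact hF.finite j
  · refine fun i => Finset.eq_empty_of_forall_notMem fun e he => ?_
    obtain ⟨r, hr⟩ := ((hmem i 0 e).1 he).1
    simp [hF.zero r] at hr
  · intro i i' j e he he'
    obtain ⟨h1, h2 | ⟨h2, h3⟩⟩ := (hmem i j e).1 he <;>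
      obtain ⟨h4, h5 | ⟨h5, h6⟩⟩ := (hmem i' j e).1 he'
    · obtain ⟨P, hP⟩ := hag' j
      exact hP.inj i i' e h2 h5
    · exact absurd (hae j ▸ ⟨i, h2⟩) h5
    · exact absurd (hae j ▸ ⟨i', h5⟩) h2
    · rw [← h3, h6]
  · intro j
    rw [hanc]
    exact hag j
  · intro i j e he
    rw [hanc]
    obtain ⟨h1, h2 | ⟨h2, rfl⟩⟩ := (hmem i j e).1 he
    · cases j with
      | zero =>
        obtain ⟨r, hr⟩ := h1
        simp [hF.zero r] at hr
      | succ j =>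
        cases h : a (j + 1 + 1) i with
        | bot => exact bot_le
        | coe f =>
          have h3 := (hag (j + 1)).allowed i f h
          simpa [allowedAfter, h2] using h3
    · exact (hsel j e h1 h2).1.1
  · intro i j e he hne i' hi'
    rw [hanc] at hne ⊢
    obtain ⟨h1, h2 | ⟨h2, rfl⟩⟩ := (hmem i j e).1 he
    · exact absurd h2.symm hne
    · exact fun hel => (hsel j e h1 h2).2 i' hel hi'
  · intro j
    rw [hanc, hae]

end GreedyFill

/-! ### Shapes of fillings -/

variable {γ : ℕ+ →₀ ℕ} {F : ℕ+ → ℕ → Finset ℕ+}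

theorem IsFilling.anchors_ne_bot (h : IsFilling γ F) {i : ℕ+} {j : ℕ} :
    anchors F j i ≠ ⊥ ↔ 1 ≤ j ∧ j ≤ γ i := by
  rw [ne_eq, anchors_eq_bot, ← ne_eq, ← Finset.nonempty_iff_ne_empty, h i j, mem_boxes]

theorem IsFilling.bounds (h : IsFilling γ F) {i e : ℕ+} {j : ℕ} (he : e ∈ F i j) :
    1 ≤ j ∧ j ≤ γ i := mem_boxes.1 ((h i j).1 ⟨e, he⟩)

theorem IsFilling.nonempty (h : IsFilling γ F) {i : ℕ+} {j : ℕ} (h1 : 1 ≤ j) (h2 : j ≤ γ i) :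
    (F i j).Nonempty := (h i j).2 (mem_boxes.2 ⟨h1, h2⟩)

theorem IsFilling.bounded (h : IsFilling γ F) : ∃ N, ∀ j, N ≤ j → ∀ i, F i j = ∅ := by
  refine ⟨γ.support.sup γ + 1, fun j hj i => Finset.eq_empty_of_forall_notMem fun e he => ?_⟩
  have h1 := h.bounds he
  have h2 : γ i ≤ γ.support.sup γ := Finset.le_sup (by rw [Finsupp.mem_support_iff]; omega)
  omega

theorem IsFilling.zero (h : IsFilling γ F) (i : ℕ+) : F i 0 = ∅ :=
  Finset.eq_empty_of_forall_notMem fun e he => absurd (h.bounds he).1 (by omega)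

theorem IsFilling.finite_columnSet (h : IsFilling γ F) (j : ℕ) : (columnSet F j).Finite := by
  refine (γ.support.biUnion fun i => F i j).finite_toSet.subset ?_
  rintro e ⟨i, hi⟩
  have h1 := h.bounds hi
  simp only [Finset.mem_coe, Finset.mem_biUnion, Finsupp.mem_support_iff]
  exact ⟨i, by omega, hi⟩

theorem IsFilling.eq_of_isFilling (h : IsFilling γ F) {γ' : ℕ+ →₀ ℕ} (h' : IsFilling γ' F) :
    γ = γ' := by
  have key : ∀ i j, 1 ≤ j → (j ≤ γ i ↔ j ≤ γ' i) := by
    intro i j hj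
    have h1 := (h i j).symm.trans (h' i j)
    rw [mem_boxes, mem_boxes] at h1
    tauto
  ext i
  have h1 := key i (γ i)
  have h2 := key i (γ' i)
  omega

/-- Anchors decrease along a row, so its non-empty boxes form an initial segment from column 1, and
their number is the row length. The first column has finitely many anchors, hence finite support. -/
theorem GreedyFill.exists_isFilling {Q R : ℕ+ → ℕ+ → Prop} (hF : GreedyFill Q R F) :
    ∃ γ, IsFilling γ F := by
  classical
  obtain ⟨N, hN⟩ := hF.bounded
  have hdown : ∀ i j k, 1 ≤ j → (F i (j + k)).Nonempty → (F i j).Nonempty := by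
    intro i j k hj
    induction k with
    | zero => exact id
    | succ k ih =>
      intro h
      apply ih
      rw [Finset.nonempty_iff_ne_empty, ne_eq, ← anchors_eq_bot] at h ⊢
      intro h1
      obtain ⟨m, hm⟩ : ∃ m, j + k = m + 1 := ⟨j + k - 1, by omega⟩
      have h2 := hF.anchors_succ_le i m
      rw [show m + 2 = j + (k + 1) by omega, ← hm, h1] at h2
      exact h (le_bot_iff.1 h2)
  have hsupp : {i | anchors F 1 i ≠ ⊥}.Finite := by
    rw [setOf_ne_bot, ← Set.encard_lt_top_iff, (hF.greedy 0).encard_rows, Set.encard_lt_top_iff]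
    exact (hF.finite_entries 1).subset fun _ h => h.1
  let g : ℕ+ → ℕ := fun i => ((Finset.range N).filter fun j => (F i (j + 1)).Nonempty).card
  refine ⟨Finsupp.ofSupportFinite g (hsupp.subset fun i hi => ?_), fun i j => ?_⟩
  · intro h
    refine hi (Finset.card_eq_zero.2 (Finset.filter_eq_empty_iff.2 fun j _ hj => ?_))
    rw [add_comm] at hj
    exact (hdown i 1 j le_rfl hj).ne_empty (anchors_eq_bot.1 h)
  · rw [mem_boxes]
    change _ ↔ 1 ≤ j ∧ j ≤ g i
    constructor
    · intro h
      have hj : 1 ≤ j := by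
        rcases Nat.eq_zero_or_pos j with rfl | hj
        · exact absurd (hF.zero i) h.ne_empty
        · exact hj
      refine ⟨hj, ?_⟩
      have hjN : j < N := by
        by_contra hc
        exact h.ne_empty (hN j (by omega) i)
      calc j = (Finset.range j).card := (Finset.card_range j).symm
        _ ≤ g i := Finset.card_le_card fun k hk => by
          rw [Finset.mem_range] at hk
          rw [Finset.mem_filter, Finset.mem_range]
          refine ⟨by omega, hdown i (k + 1) (j - (k + 1)) (by omega) ?_⟩
          rwa [show k + 1 + (j - (k + 1)) = j by omega]
    · rintro ⟨h1, h2⟩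
      by_contra hc
      have h3 : g i ≤ (Finset.range (j - 1)).card := Finset.card_le_card fun k hk => by
        rw [Finset.mem_filter] at hk
        rw [Finset.mem_range]
        by_contra hkj
        refine hc (hdown i j (k + 1 - j) h1 ?_)
        rw [show j + (k + 1 - j) = k + 1 by omega]
        exact hk.2
      rw [Finset.card_range] at h3
      omega

/-! ### Skyline fillings as greedy fillings -/

theorem anchor_withBasement_zero (F : ℕ+ → ℕ → Finset ℕ+) (i : ℕ+) :
    anchor (withBasement F i 0) = i := by
  simp [anchor, withBasement]

theorem anchor_withBasement_succ (F : ℕ+ → ℕ → Finset ℕ+) (i : ℕ+) (j : ℕ) :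
    anchor (withBasement F i (j + 1)) = anchors F (j + 1) i := by
  simp [anchors, withBasement]

theorem allowedAfter_le_iff (F : ℕ+ → ℕ → Finset ℕ+) (i e : ℕ+) (j : ℕ) :
    allowedAfter (fun i e => e ≤ i) j (anchors F j) i e ↔
      (e : WithBot ℕ+) ≤ anchor (withBasement F i j) := by
  cases j with
  | zero => simp [allowedAfter, anchor_withBasement_zero]
  | succ j => simp [allowedAfter, anchor_withBasement_succ]

theorem IsFilling.nonempty_withBasement (h : IsFilling γ F) {i : ℕ+} {j : ℕ} (hj : j ≤ γ i) :
    (withBasement F i j).Nonempty := by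
  cases j with
  | zero => simp [withBasement]
  | succ j => simpa [withBasement] using h.nonempty (by omega) hj

theorem IsFilling.anchors_succ_le_withBasement (h : IsFilling γ F) {i : ℕ+}
    (hrow : RowDecreasing (withBasement F i)) (j : ℕ) :
    anchors F (j + 1) i ≤ anchor (withBasement F i j) := by
  refine Finset.max_le fun e he => ?_
  obtain ⟨x, hx⟩ := h.nonempty_withBasement (i := i) (j := j) (by have := h.bounds he; omega)
  refine le_trans ?_ (Finset.le_max hx)
  exact WithBot.coe_le_coe.2 (hrow j x hx e (by simpa [withBasement] using he))

/-- This translates (S4) into `Eligible`. Only the right neighbour matters, because the left one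
already dominates the anchor, which is larger than `e`. -/
theorem rowDecreasing_update_iff {i e : ℕ+} {j : ℕ} (hj : 1 ≤ j)
    (hrow : RowDecreasing (withBasement F i)) (he : (e : WithBot ℕ+) < anchors F j i) :
    RowDecreasing (Function.update (withBasement F i) j (insert e (F i j))) ↔
      anchors F (j + 1) i ≤ e := by
  obtain ⟨m, hm⟩ := WithBot.ne_bot_iff_exists.1 he.ne_bot
  have hm' : m ∈ F i j := mem_of_anchors hm.symm
  rw [← hm, WithBot.coe_lt_coe] at he
  have hself : withBasement F i j = F i j := by
    simp [withBasement, show j ≠ 0 by omega]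
  constructor
  · intro h
    refine Finset.max_le fun y hy => WithBot.coe_le_coe.2 ?_
    have h1 := h j
    rw [Function.update_self, Function.update_of_ne (by omega)] at h1
    exact h1 e (Finset.mem_insert_self ..) y (by simpa [withBasement] using hy)
  · intro h k
    rcases eq_or_ne k j with rfl | hk
    · rw [Function.update_self, Function.update_of_ne (by omega)]
      intro x hx y hy
      rcases Finset.mem_insert.1 hx with rfl | hx
      · exact WithBot.coe_le_coe.1 ((le_anchors (by simpa [withBasement] using hy)).trans h)
      · exact hrow k x (hself ▸ hx) y hy
    · rw [Function.update_of_ne hk]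
      rcases eq_or_ne (k + 1) j with rfl | hk'
      · rw [Function.update_self]
        intro x hx y hy
        rcases Finset.mem_insert.1 hy with rfl | hy
        · exact he.le.trans (hrow k x hx m (hself ▸ hm'))
        · exact hrow k x hx y (hself ▸ hy)
      · rw [Function.update_of_ne hk']
        exact hrow k

theorem IsSetSkyFill.greedyFill (h : IsSetSkyFill γ F) :
    GreedyFill (fun i e => e ≤ i) (· < ·) F := by
  have hle := fun i j => h.filling.anchors_succ_le_withBasement (h.row i) j
  refine ⟨h.filling.bounded, h.filling.finite_columnSet, h.filling.zero, ?_, ?_, ?_, ?_⟩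
  · intro i i' j e he he'
    by_contra hne
    exact Finset.disjoint_left.1 (h.column i i' j hne) he he'
  · intro j
    refine ⟨?_, ?_, ?_⟩
    · intro i e he
      rw [allowedAfter_le_iff, ← he]
      exact hle i j
    · intro i r e hi hr
      by_contra hne
      exact Finset.disjoint_left.1 (h.column i r (j + 1) hne) (mem_of_anchors hi)
        (mem_of_anchors hr)
    · intro i r e hir hr hP
      rw [allowedAfter_le_iff] at hP
      have hjr := h.filling.bounds (mem_of_anchors hr)
      -- If the upper row is weakly longer, `e` being allowed there rules out the alternative `b >
      -- c` of the type A triple, leaving `a > b`.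
      rcases le_or_gt (γ r) (γ i) with hγ | hγ
      · rcases h.tripleA i r j hir hγ hjr.2 with h1 | h1
        · change _ < anchors F (j + 1) r ∧ _ at h1
          rw [hr] at h1
          exact absurd hP h1.1.not_ge
        · change _ ∧ anchors F (j + 1) r < anchors F (j + 1) i at h1
          rw [← hr]
          exact h1.2
      -- If the lower row is longer, type B triples propagate from the basement: each anchor of the
      -- lower row exceeds the preceding anchor of the upper row, so `e` is never allowed there.
      · have key : ∀ k ≤ γ i, anchor (withBasement F i k) < anchors F (k + 1) r := by
          intro k
          induction k with
          | zero =>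
            intro _
            rcases h.tripleB i r 0 hir hγ (by omega) with h1 | h1
            · rw [anchor_withBasement_zero, anchor_withBasement_zero, WithBot.coe_lt_coe] at h1
              exact absurd h1.1 hir.not_gt
            · exact h1.2
          | succ k ih =>
            intro hk
            rcases h.tripleB i r (k + 1) hir hγ hk with h1 | h1
            · refine absurd h1.1 (le_of_lt ?_).not_gt
              rw [anchor_withBasement_succ, anchor_withBasement_succ]
              exact (hle i k).trans_lt (ih (by omega))
            · exact h1.2
        rcases le_or_gt j (γ i) with hj | hj
        · have h1 := key j hj
          rw [hr] at h1
          exact absurd hP h1.not_ge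
        · obtain ⟨k, rfl⟩ : ∃ k, j = k + 1 := ⟨j - 1, by omega⟩
          have h1 : anchors F (k + 1) i = ⊥ := by
            by_contra hc
            have := h.filling.anchors_ne_bot.1 hc
            omega
          rw [anchor_withBasement_succ, h1] at hP
          exact absurd (le_bot_iff.1 hP) WithBot.coe_ne_bot
  · intro i j e he
    refine Finset.max_le fun y hy => WithBot.coe_le_coe.2 ?_
    have hj := h.filling.bounds he
    exact h.row i j e (by simpa [withBasement, show j ≠ 0 by omega] using he) y
      (by simpa [withBasement] using hy)
  · intro i j e he hne i' hi' hel
    have hj := h.filling.bounds he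
    have hb : (i', j) ∈ boxes γ :=
      mem_boxes.2 (h.filling.anchors_ne_bot.1 hel.2.ne_bot)
    exact h.free i j e he hne i' hi' hb hel.2
      ((rowDecreasing_update_iff hj.1 (h.row i') hel.2).2 hel.1)

theorem GreedyFill.isSetSkyFill (hF : GreedyFill (fun i e => e ≤ i) (· < ·) F)
    (h : IsFilling γ F) : IsSetSkyFill γ F := by
  have hrow : ∀ i, RowDecreasing (withBasement F i) := by
    intro i j x hx y hy
    replace hy : y ∈ F i (j + 1) := by simpa [withBasement] using hy
    cases j with
    | zero =>
      obtain rfl : x = i := by simpa [withBasement] using hx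
      obtain ⟨m, hm⟩ := WithBot.ne_bot_iff_exists.1
        (h.anchors_ne_bot.2 (h.bounds hy))
      have h1 := (hF.greedy 0).allowed x m hm.symm
      have h2 := le_anchors hy
      rw [zero_add] at h2
      rw [allowedAfter, if_pos rfl] at h1
      rw [← hm, WithBot.coe_le_coe] at h2
      exact h2.trans h1
    | succ j =>
      exact WithBot.coe_le_coe.1 ((le_anchors hy).trans
        (hF.row i (j + 1) x (by simpa [withBasement] using hx)))
  have hle := fun i j => h.anchors_succ_le_withBasement (hrow i) j
  have hgr : ∀ i r j, i < r → anchors F (j + 1) r ≠ ⊥ →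
      anchors F (j + 1) r ≤ anchor (withBasement F i j) →
      anchors F (j + 1) r < anchors F (j + 1) i := by
    intro i r j hir hb hP
    obtain ⟨e, he⟩ := WithBot.ne_bot_iff_exists.1 hb
    rw [← he] at hP ⊢
    exact (hF.greedy j).greedy i r e hir he.symm ((allowedAfter_le_iff F i e j).2 hP)
  refine ⟨h, ?_, hrow, ?_, ?_, ?_⟩
  · intro i i' j hne
    rw [Finset.disjoint_left]
    exact fun e he he' => hne (hF.disjoint i i' j e he he')
  · intro i i' j hi hγ hj
    rcases le_or_gt (anchors F (j + 1) i') (anchor (withBasement F i j)) with h1 | h1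
    · exact Or.inr ⟨hle i j, hgr i i' j hi (h.anchors_ne_bot.2 ⟨by omega, hj⟩) h1⟩
    · exact Or.inl ⟨h1, hle i j⟩
  · intro i i' j hi hγ hj
    refine Or.inr ⟨hle i' j, ?_⟩
    change anchor (withBasement F i j) < anchors F (j + 1) i'
    by_contra hcon
    rw [not_lt] at hcon
    -- One failure of type B propagates to the right: greediness keeps the upper anchors larger up
    -- to the end of the upper row, then demands a box in column `γ i + 1`, which is absent.
    have key : ∀ k, j + k ≤ γ i →
        anchors F (j + k + 1) i' ≤ anchor (withBasement F i (j + k)) := by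
      intro k
      induction k with
      | zero => exact fun _ => hcon
      | succ k ih =>
        intro hk
        have h1 := hgr i i' (j + k) hi (h.anchors_ne_bot.2 ⟨by omega, by omega⟩)
          (ih (by omega))
        rw [show j + (k + 1) = j + k + 1 by omega, anchor_withBasement_succ]
        have h2 := hle i' (j + k + 1)
        rw [anchor_withBasement_succ] at h2
        exact h2.trans h1.le
    have h1 := key (γ i - j) (by omega)
    rw [show j + (γ i - j) = γ i by omega] at h1
    have h2 := hgr i i' (γ i) hi (h.anchors_ne_bot.2 ⟨by omega, by omega⟩) h1
    have h3 := h.anchors_ne_bot.1 h2.ne_bot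
    omega
  · intro i j e he hne i' hi' hb hlt hr
    have h1 := (rowDecreasing_update_iff (h.bounds he).1 (hrow i') hlt).1 hr
    exact hF.free i j e he hne i' hi' ⟨h1, hlt⟩

/-! ### Reverse tableaux as greedy fillings -/

/-- Strictness passes through the intermediate rows, whose boxes are non-empty because `lam` is a
partition. -/
theorem IsSetRT.setGT {lam : ℕ+ →₀ ℕ} (hlam : Antitone lam) {T : ℕ+ → ℕ → Finset ℕ+}
    (h : IsSetRT lam T) (j : ℕ) {i r : ℕ+} (hir : i < r) : SetGT (T i j) (T r j) := by
  obtain ⟨k, rfl⟩ : ∃ k, r = i + k := ⟨r - i, (PNat.add_sub_of_lt hir).symm⟩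
  clear hir
  induction k using PNat.recOn with
  | one => exact h.column i j
  | succ k ih =>
    intro x hx y hy
    rw [← add_assoc] at hy
    have h1 := h.filling.bounds hy
    have h2 : lam (i + k + 1) ≤ lam (i + k) := hlam (PNat.lt_add_right _ _).le
    obtain ⟨z, hz⟩ := h.filling.nonempty (i := i + k) h1.1 (by omega)
    exact (h.column (i + k) j z hz y hy).trans (ih x hx z hz)

/-- Every entry of a row exceeds all entries of the lower rows in its column. Thus greediness is
automatic, and no lower row can hold a given free entry below its anchor. -/
theorem IsSetRT.greedyFill {lam : ℕ+ →₀ ℕ} (hlam : Antitone lam) {T : ℕ+ → ℕ → Finset ℕ+}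
    (h : IsSetRT lam T) : GreedyFill (fun _ _ => True) (· > ·) T := by
  have hdisj : ∀ i i' j e, e ∈ T i j → e ∈ T i' j → i = i' := by
    intro i i' j e he he'
    rcases lt_trichotomy i i' with hlt | heq | hlt
    · exact absurd (h.setGT hlam j hlt e he e he') (lt_irrefl _)
    · exact heq
    · exact absurd (h.setGT hlam j hlt e he' e he) (lt_irrefl _)
  refine ⟨h.filling.bounded, h.filling.finite_columnSet, h.filling.zero, hdisj, ?_, ?_, ?_⟩
  · intro j
    refine ⟨?_, ?_, ?_⟩
    · intro i e he
      cases j with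
      | zero => simp [allowedAfter]
      | succ j =>
        have h1 := h.filling.bounds (mem_of_anchors he)
        obtain ⟨m, hm⟩ := h.filling.nonempty (i := i) (j := j + 1) (by omega) (by omega)
        simp only [allowedAfter, Nat.add_eq_zero_iff, one_ne_zero, and_false, if_false]
        exact (WithBot.coe_le_coe.2 (h.row i (j + 1) m hm e (mem_of_anchors he))).trans
          (le_anchors hm)
    · exact fun i r e hi hr => hdisj i r (j + 1) e (mem_of_anchors hi) (mem_of_anchors hr)
    · intro i r e hir hr _
      have h1 := h.filling.bounds (mem_of_anchors hr)
      have h2 : lam r ≤ lam i := hlam hir.le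
      obtain ⟨m, hm⟩ := h.filling.nonempty (i := i) (j := j + 1) (by omega) (by omega)
      exact (WithBot.coe_lt_coe.2 (h.setGT hlam _ hir m hm e (mem_of_anchors hr))).trans_le
        (le_anchors hm)
  · exact fun i j e he => Finset.max_le fun y hy => WithBot.coe_le_coe.2 (h.row i j e he y hy)
  · intro i j e he _ i' hi' hel
    obtain ⟨m, hm⟩ := WithBot.ne_bot_iff_exists.1 hel.2.ne_bot
    have h1 := h.setGT hlam j hi' e he m (mem_of_anchors hm.symm)
    have h2 := hel.2
    rw [← hm, WithBot.coe_lt_coe] at h2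
    exact h2.not_gt h1

/-- By induction on the column, an anchor of a lower row is always allowed in every higher row, so
greediness forces a larger anchor there. -/
theorem GreedyFill.anchors_lt {R : ℕ+ → ℕ+ → Prop} (hF : GreedyFill (fun _ _ => True) R F)
    {i r : ℕ+} (hir : i < r) (j : ℕ) (hr : anchors F j r ≠ ⊥) :
    anchors F j r < anchors F j i := by
  induction j with
  | zero => simp [hF.anchors_zero] at hr
  | succ j ih =>
    obtain ⟨e, he⟩ := WithBot.ne_bot_iff_exists.1 hr
    rw [← he]
    refine (hF.greedy j).greedy i r e hir he.symm ?_
    cases j with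
    | zero => simp [allowedAfter]
    | succ j =>
      simp only [allowedAfter, Nat.add_eq_zero_iff, one_ne_zero, and_false, if_false]
      have h1 := hF.anchors_succ_le r j
      rw [← he] at h1
      exact h1.trans (ih (ne_bot_of_le_ne_bot WithBot.coe_ne_bot h1)).le

theorem GreedyFill.antitone {R : ℕ+ → ℕ+ → Prop} (hF : GreedyFill (fun _ _ => True) R F)
    (h : IsFilling γ F) : Antitone γ := by
  intro i r hir
  rcases hir.eq_or_lt with rfl | hir
  · exact le_rfl
  · rcases Nat.eq_zero_or_pos (γ r) with h0 | h0
    · omega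
    · exact (h.anchors_ne_bot.1 (hF.anchors_lt hir (γ r) (h.anchors_ne_bot.2 ⟨h0, le_rfl⟩)).ne_bot).2

theorem GreedyFill.isSetRT (hF : GreedyFill (fun _ _ => True) (· > ·) F)
    (h : IsFilling γ F) : IsSetRT γ F := by
  refine ⟨h, ?_, ?_⟩
  · intro i j x hx y hy
    exact WithBot.coe_le_coe.1 ((le_anchors hy).trans (hF.row i j x hx))
  · intro i j x hx y hy
    have hii : i < i + 1 := PNat.lt_add_right i 1
    have hlt := hF.anchors_lt hii j (h.anchors_ne_bot.2 (h.bounds hy))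
    refine WithBot.coe_lt_coe.1 ((le_anchors hy).trans_lt ?_)
    by_cases hxa : (x : WithBot ℕ+) = anchors F j i
    · rwa [hxa]
    -- A free `x` below the anchor of row `i + 1` was not moved down, so the next anchor of row `i +
    -- 1` exceeds `x`. Then so does the next anchor of row `i`, against the row condition.
    · by_contra hcon
      rw [not_lt] at hcon
      have hlt' : (x : WithBot ℕ+) < anchors F j (i + 1) := by
        refine lt_of_le_of_ne hcon fun heq => hii.ne ?_
        exact hF.disjoint i (i + 1) j x hx (mem_of_anchors heq.symm)
      have h1 : (x : WithBot ℕ+) < anchors F (j + 1) (i + 1) := by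
        by_contra hc
        exact hF.free i j x hx hxa (i + 1) hii ⟨not_lt.1 hc, hlt'⟩
      have h2 := hF.anchors_lt hii (j + 1) h1.ne_bot
      exact ((h1.trans h2).trans_le (hF.row i j x hx)).false

/-! ### Contents and shapes -/

/-- An entry occurs at most once per column, so its multiplicity counts columns and depends only on
the column sets. -/
theorem content_apply {Q R : ℕ+ → ℕ+ → Prop} {γ : ℕ+ →₀ ℕ} {F : ℕ+ → ℕ → Finset ℕ+}
    (hF : GreedyFill Q R F) (h : IsFilling γ F) (e : ℕ+) :
    content γ F e = {j | e ∈ columnSet F j}.ncard := by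
  classical
  have h1 : content γ F e = ((boxes γ).filter fun c => e ∈ F c.1 c.2).card := by
    rw [content, Finsupp.finsetSum_apply, Finset.card_filter]
    refine Finset.sum_congr rfl fun c _ => ?_
    rw [Finsupp.finsetSum_apply]
    simp [Finsupp.single_apply]
  have h2 : {j | e ∈ columnSet F j} =
      (((boxes γ).filter fun c => e ∈ F c.1 c.2).image Prod.snd : Finset ℕ) := by
    ext j
    simp only [columnSet, Set.mem_ofPred_eq, Finset.coe_image, Set.mem_image, Finset.mem_coe,
      Finset.mem_filter, Prod.exists, exists_eq_right]
    exact exists_congr fun i => ⟨fun hi => ⟨(h i j).1 ⟨e, hi⟩, hi⟩, fun hi => hi.2⟩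
  rw [h1, h2, Set.ncard_coe_finset, Finset.card_image_of_injOn]
  rintro ⟨i, j⟩ hc ⟨i', j'⟩ hc' (rfl : j = j')
  rw [Finset.mem_coe, Finset.mem_filter] at hc hc'
  rw [hF.disjoint i i' j e hc.2 hc'.2]

theorem content_eq {Q R Q' R' : ℕ+ → ℕ+ → Prop} {γ γ' : ℕ+ →₀ ℕ} {F F' : ℕ+ → ℕ → Finset ℕ+}
    (hF : GreedyFill Q R F) (h : IsFilling γ F) (hF' : GreedyFill Q' R' F')
    (h' : IsFilling γ' F') (hc : ∀ j, columnSet F j = columnSet F' j) :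
    content γ F = content γ' F' := by
  ext e
  simp only [content_apply hF h, content_apply hF' h', hc]

theorem encard_setOf_lt {Q R : ℕ+ → ℕ+ → Prop} {γ : ℕ+ →₀ ℕ} {F : ℕ+ → ℕ → Finset ℕ+}
    (hF : GreedyFill Q R F) (h : IsFilling γ F) (j : ℕ) :
    {i | j < γ i}.encard = (entries (anchors F (j + 1))).encard := by
  have h1 : {i | j < γ i} = {i | anchors F (j + 1) i ≠ ⊥} := by
    ext i
    change _ ↔ anchors F (j + 1) i ≠ ⊥
    rw [h.anchors_ne_bot]
    exact ⟨fun h => ⟨by omega, h⟩, fun h => h.2⟩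
  rw [h1, setOf_ne_bot, (hF.greedy j).encard_rows]
  simp

theorem countP_lt_parts (γ : ℕ+ →₀ ℕ) (j : ℕ) :
    (((γ.support.val.map γ).countP (j < ·) : ℕ) : ℕ∞) = {i | j < γ i}.encard := by
  have h1 : {i | j < γ i} = (γ.support.filter fun i => j < γ i : Finset ℕ+) := by
    ext i
    simp only [Set.mem_ofPred_eq, Finset.coe_filter, Finsupp.mem_support_iff]
    exact ⟨fun h => ⟨by omega, h⟩, fun h => h.2⟩
  rw [h1, Set.encard_coe_eq_coe_finsetCard, Multiset.countP_map]
  rfl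

theorem countP_lt_eq_count_add (s : Multiset ℕ) (n : ℕ) :
    s.countP (n < ·) = s.count (n + 1) + s.countP (n + 1 < ·) := by
  induction s using Multiset.induction_on with
  | empty => simp
  | cons a s ih =>
    rw [Multiset.countP_cons, Multiset.countP_cons, Multiset.count_cons, ih]
    split_ifs <;> omega

/-- Column heights determine the parts: the multiplicity of `n + 1` is the difference of two
successive heights, and `0` never occurs on the support. -/
theorem sameParts_iff {γ γ' : ℕ+ →₀ ℕ} :
    SameParts γ γ' ↔ ∀ j, {i | j < γ i}.encard = {i | j < γ' i}.encard := by
  constructor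
  · intro h j
    rw [← countP_lt_parts, ← countP_lt_parts, h]
  · intro h
    have h1 : ∀ j, (γ.support.val.map γ).countP (j < ·) =
        (γ'.support.val.map γ').countP (j < ·) := fun j => by
      have := h j
      rw [← countP_lt_parts, ← countP_lt_parts] at this
      exact_mod_cast this
    have h0 : ∀ δ : ℕ+ →₀ ℕ, (δ.support.val.map δ).count 0 = 0 := fun δ => by
      rw [Multiset.count_eq_zero]
      simp
    refine Multiset.ext.2 fun n => ?_
    cases n with
    | zero => rw [h0, h0]
    | succ n =>
      have h2 := h1 n
      rw [countP_lt_eq_count_add _ n, countP_lt_eq_count_add _ n, h1 (n + 1)] at h2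
      omega

theorem SameParts.size_eq {γ γ' : ℕ+ →₀ ℕ} (h : SameParts γ γ') : size γ = size γ' :=
  congrArg Multiset.sum h

/-- For a partition, the rows reaching a given column form an initial segment of `ℕ+`, determined by
its finite size. -/
theorem SameParts.eq_of_antitone {γ γ' : ℕ+ →₀ ℕ} (h : SameParts γ γ') (hγ : Antitone γ)
    (hγ' : Antitone γ') : γ = γ' := by
  have key : ∀ j, {i | j < γ i} = {i | j < γ' i} := by
    intro j
    have hfin : ∀ δ : ℕ+ →₀ ℕ, {i | j < δ i}.Finite := fun δ =>
      δ.support.finite_toSet.subset fun i hi => by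
        rw [Finset.mem_coe, Finsupp.mem_support_iff]
        exact (pos_of_gt hi).ne'
    have h1 := sameParts_iff.1 h j
    have hl : ∀ δ : ℕ+ →₀ ℕ, Antitone δ → IsLowerSet {i | j < δ i} :=
      fun δ hδ a b hba ha => lt_of_lt_of_le ha (hδ hba)
    rcases (hl γ hγ).total (hl γ' hγ') with hs | hs
    · exact (hfin γ).eq_of_subset_of_encard_le hs h1.ge
    · exact ((hfin γ').eq_of_subset_of_encard_le hs h1.le).symm
  ext i
  have h1 : ∀ j, j < γ i ↔ j < γ' i := fun j => Set.ext_iff.1 (key j) i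
  exact eq_of_forall_lt_iff h1

/-! ### The bijection -/

/-- The two fillings have the same anchors and the same entries in each column. -/
def SameColumns (F F' : ℕ+ → ℕ → Finset ℕ+) : Prop :=
  (∀ j, entries (anchors F j) = entries (anchors F' j)) ∧ ∀ j, columnSet F j = columnSet F' j

theorem SameColumns.symm {F F' : ℕ+ → ℕ → Finset ℕ+} (h : SameColumns F F') :
    SameColumns F' F := ⟨fun j => (h.1 j).symm, fun j => (h.2 j).symm⟩

theorem SameColumns.trans {F F' F'' : ℕ+ → ℕ → Finset ℕ+} (h : SameColumns F F')
    (h' : SameColumns F' F'') : SameColumns F F'' :=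
  ⟨fun j => (h.1 j).trans (h'.1 j), fun j => (h.2 j).trans (h'.2 j)⟩

theorem SameColumns.sameParts {Q R Q' R' : ℕ+ → ℕ+ → Prop} {γ γ' : ℕ+ →₀ ℕ}
    {F F' : ℕ+ → ℕ → Finset ℕ+} (hF : GreedyFill Q R F) (h : IsFilling γ F)
    (hF' : GreedyFill Q' R' F') (h' : IsFilling γ' F') (hs : SameColumns F F') :
    SameParts γ γ' :=
  sameParts_iff.2 fun j => by rw [encard_setOf_lt hF h, encard_setOf_lt hF' h', hs.1]

/-- Rearrange for the basement `b_i = i`, sending each free entry to its highest eligible row; the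
shape `γ` is an output of the construction. -/
theorem exists_isSetSkyFill {lam : ℕ+ →₀ ℕ} (hlam : Antitone lam) {T : ℕ+ → ℕ → Finset ℕ+}
    (hT : IsSetRT lam T) : ∃ γ F, SameParts γ lam ∧ IsSetSkyFill γ F ∧ SameColumns F T ∧
      content γ F = content lam T := by
  have hT' := hT.greedyFill hlam
  obtain ⟨F, hF, hs⟩ := hT'.exists_rearrangement (Q' := fun i e => e ≤ i) (R' := (· < ·))
    (fun e => Set.infinite_of_not_bddAbove (not_bddAbove_Ici e))
    (fun s hs hne => by
      obtain ⟨m, hm, hmin⟩ := Set.exists_min_image s id hs hne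
      exact ⟨m, hm, fun i hi => (hmin i hi).not_gt⟩)
  obtain ⟨γ, hγ⟩ := hF.exists_isFilling
  have hs' : SameColumns F T := SameColumns.symm hs
  exact ⟨γ, F, hs'.sameParts hF hγ hT' hT.filling, hF.isSetSkyFill hγ, hs',
    content_eq hF hγ hT' hT.filling hs'.2⟩

/-- Rearrange without a basement restriction, sending free entries to their lowest eligible rows.
The resulting shape is a partition with the parts of `lam`, hence `lam` itself. -/
theorem exists_isSetRT {lam γ : ℕ+ →₀ ℕ} (hlam : Antitone lam) (hγ : SameParts γ lam)
    {F : ℕ+ → ℕ → Finset ℕ+} (hF : IsSetSkyFill γ F) :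
    ∃ T, IsSetRT lam T ∧ SameColumns F T ∧ content lam T = content γ F := by
  have hF' := hF.greedyFill
  obtain ⟨T, hT, hs⟩ := hF'.exists_rearrangement (Q' := fun _ _ => True) (R' := (· > ·))
    (fun e => by simpa using Set.infinite_univ)
    (fun s hs hne => by
      obtain ⟨m, hm, hmax⟩ := Set.exists_max_image s id hs hne
      exact ⟨m, hm, fun i hi => (hmax i hi).not_gt⟩)
  obtain ⟨δ, hδ⟩ := hT.exists_isFilling
  have hp : SameParts δ lam :=
    (SameColumns.sameParts hT hδ hF' hF.filling (SameColumns.symm hs)).trans hγ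
  obtain rfl := hp.eq_of_antitone (hT.antitone hδ) hlam
  exact ⟨T, hT.isSetRT hδ, hs, content_eq hT hδ hF' hF.filling fun j => (hs.2 j).symm⟩

theorem IsSetSkyFill.eq_of_sameColumns {γ γ' : ℕ+ →₀ ℕ} {F F' : ℕ+ → ℕ → Finset ℕ+}
    (hF : IsSetSkyFill γ F) (hF' : IsSetSkyFill γ' F') (hs : SameColumns F F') :
    γ = γ' ∧ F = F' := by
  obtain rfl := hF.greedyFill.eq_of_entries_eq hF'.greedyFill hs.1 hs.2
  exact ⟨hF.filling.eq_of_isFilling hF'.filling, rfl⟩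

theorem IsSetRT.eq_of_sameColumns {lam : ℕ+ →₀ ℕ} (hlam : Antitone lam)
    {T T' : ℕ+ → ℕ → Finset ℕ+} (hT : IsSetRT lam T) (hT' : IsSetRT lam T')
    (hs : SameColumns T T') : T = T' :=
  (hT.greedyFill hlam).eq_of_entries_eq (hT'.greedyFill hlam) hs.1 hs.2

theorem coeff_lascouxAtom (γ d : ℕ+ →₀ ℕ) [DecidablePred fun F => content γ F = d] :
    MvPolynomial.coeff d (lascouxAtom γ) =
      ((finite_setSkyFill γ).toFinset.filter fun F => content γ F = d).card •
        (X ^ (size d - size γ) : ℤ[X]) := by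
  classical
  rw [lascouxAtom, MvPolynomial.coeff_sum, ← Finset.sum_const, Finset.sum_filter]
  refine Finset.sum_congr rfl fun F _ => ?_
  rw [MvPolynomial.coeff_monomial]
  split_ifs with h
  · rw [h]
  · rfl

theorem coeff_grothendieck (lam d : ℕ+ →₀ ℕ) :
    MvPowerSeries.coeff d (grothendieck lam) =
      (finite_setRT lam d).toFinset.card • (X ^ (size d - size lam) : ℤ[X]) := by
  change ∑ T ∈ (finite_setRT lam d).toFinset, X ^ (size (content lam T) - size lam) = _
  rw [← Finset.sum_const]
  refine Finset.sum_congr rfl fun T hT => ?_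
  rw [Set.Finite.mem_toFinset] at hT
  rw [hT.2]

end SkylineFilling

/-! ### Comparison of coefficients -/

theorem theorem1p2 (lam : ℕ+ →₀ ℕ) (hlam : Antitone lam) :
    SkylineFilling.IsFormalSum
      (fun γ : {γ : ℕ+ →₀ ℕ // SkylineFilling.SameParts γ lam} =>
        (SkylineFilling.lascouxAtom γ.1 : MvPowerSeries ℕ+ (Polynomial ℤ)))
      (SkylineFilling.grothendieck lam) := by
  classical
  open SkylineFilling in
  intro d
  let S (γ : {γ : ℕ+ →₀ ℕ // SameParts γ lam}) :=
    (finite_setSkyFill γ.1).toFinset.filter fun F => content γ.1 F = d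
  have hS : ∀ γ F, F ∈ S γ ↔ IsSetSkyFill γ.1 F ∧ content γ.1 F = d := fun γ F => by simp [S]
  let ST := (finite_setRT lam d).toFinset
  have hST : ∀ T, T ∈ ST ↔ IsSetRT lam T ∧ content lam T = d := fun T => by simp [ST]
  -- The power of `β` depends only on `d` and on the common size of the shapes, so the identity
  -- reduces to a count of fillings.
  have hcoeff : ∀ γ : {γ : ℕ+ →₀ ℕ // SameParts γ lam},
      MvPowerSeries.coeff d (lascouxAtom γ.1 : MvPowerSeries ℕ+ (Polynomial ℤ)) =
        (S γ).card • (Polynomial.X ^ (size d - size lam) : Polynomial ℤ) := fun γ => by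
    rw [MvPolynomial.coeff_coe, coeff_lascouxAtom, γ.2.size_eq]
  have hto : ∀ γ F, F ∈ S γ → ∃ T, T ∈ ST ∧ SameColumns F T := fun γ F hF => by
    rw [hS] at hF
    obtain ⟨T, hT, hs, hc⟩ := exists_isSetRT hlam γ.2 hF.1
    exact ⟨T, (hST T).2 ⟨hT, hc.trans hF.2⟩, hs⟩
  -- Each of the finitely many tableaux of content `d` shares its columns with fillings of at most
  -- one shape.
  have hfin : {γ | (S γ).Nonempty}.Finite := by
    refine (ST.finite_toSet.biUnion
      (t := fun T => {γ | ∃ F ∈ S γ, SameColumns F T}) fun T _ => ?_).subset ?_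
    · refine Set.Subsingleton.finite ?_
      rintro γ ⟨F, hF, hs⟩ γ' ⟨F', hF', hs'⟩
      exact Subtype.ext (((hS γ F).1 hF).1.eq_of_sameColumns ((hS γ' F').1 hF').1
        (hs.trans hs'.symm)).1
    · rintro γ ⟨F, hF⟩
      obtain ⟨T, hT, hs⟩ := hto γ F hF
      exact Set.mem_biUnion (Finset.mem_coe.2 hT) ⟨F, hF, hs⟩
  have hsub : ∀ γ : {γ : ℕ+ →₀ ℕ // SameParts γ lam}, MvPowerSeries.coeff d
      (lascouxAtom γ.1 : MvPowerSeries ℕ+ (Polynomial ℤ)) ≠ 0 → (S γ).Nonempty := by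
    intro γ hγ
    by_contra hne
    rw [hcoeff, Finset.not_nonempty_iff_eq_empty.1 hne, Finset.card_empty, zero_smul] at hγ
    exact hγ rfl
  refine ⟨hfin.subset hsub, ?_⟩
  rw [finsum_eq_sum_of_support_subset (s := hfin.toFinset) _ fun γ hγ => by
    rw [hfin.coe_toFinset]; exact hsub γ hγ]
  simp only [hcoeff]
  rw [← Finset.sum_smul, ← Finset.card_sigma, coeff_grothendieck]
  congr 1
  symm
  refine Finset.card_bij (fun x hx => (hto x.1 x.2 (Finset.mem_sigma.1 hx).2).choose) ?_ ?_ ?_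
  · exact fun x hx => (hto x.1 x.2 (Finset.mem_sigma.1 hx).2).choose_spec.1
  · rintro ⟨γ, F⟩ hx ⟨γ', F'⟩ hx' heq
    have h1 := (Finset.mem_sigma.1 hx).2
    have h2 := (Finset.mem_sigma.1 hx').2
    have hs := (hto γ F h1).choose_spec.2
    have hs' := (hto γ' F' h2).choose_spec.2
    simp only at heq
    rw [heq] at hs
    obtain ⟨h3, rfl⟩ := ((hS γ F).1 h1).1.eq_of_sameColumns ((hS γ' F').1 h2).1
      (hs.trans hs'.symm)
    obtain rfl := Subtype.ext h3
    rfl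
  · intro T hT
    have hT' := (hST T).1 hT
    obtain ⟨γ, F, hp, hF, hs, hc⟩ := exists_isSetSkyFill hlam hT'.1
    have hFS : F ∈ S ⟨γ, hp⟩ := (hS _ _).2 ⟨hF, hc.trans hT'.2⟩
    refine ⟨⟨⟨γ, hp⟩, F⟩, Finset.mem_sigma.2 ⟨hfin.mem_toFinset.2 ⟨F, hFS⟩, hFS⟩, ?_⟩
    have hspec := (hto ⟨γ, hp⟩ F hFS).choose_spec
    exact ((hST _).1 hspec.1).1.eq_of_sameColumns hlam hT'.1 (hspec.2.symm.trans hs)
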